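/- For an entire function $f$, its order is the infimum of all $A\ge 0$ such that $f(z)=O(e^{|z|^A})$ as $|z|\to\infty$. Let $g$ and $h$ be even entire functions, each of order lying in $(0,2)$, with $g(0)=h(0)=1$. Let $(a_n)_{n\ge1}$ and $(b_n)_{n\ge1}$ be strictly increasing sequences of positive real numbers tending to infinity, such that the zeros of $g$ are exactly the numbers $\pm a_n$, the zeros of $h$ are exactly the numbers $\pm b_n$, and all these zeros are simple. Assume that $a_n<b_n$ for all $n\ge1$. Then there is a probability measure $\mu$ on $\mathbb{R}$ whose characteristic function is $$\int_{\mathbb{R}} e^{itx}\,\mu(dx)=\frac{h(it)}{g(it)}\qquad (t\in\mathbb{R}).$$ Moreover, $\mu$ is the infinite convolution of the probability measures $$\nu_n=\frac{a_n^2}{b_n^2}\,\delta_0+\Bigl(1-\frac{a_n^2}{b_n^2}\Bigr)\,\mathrm{Laplace}(a_n),\qquad n\ge 1,$$ where $\mathrm{Laplace}(a)$ is the law with density $\frac a2 e^{-a|x|}$ on $\mathbb{R}$; that is, $\nu_1\star\cdots\star\nu_N$ converges weakly to $\mu$ as $N\to\infty$, and the products of the characteristic functions of $\nu_1,\dots,\nu_N$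 converge to the characteristic function of $\mu$ uniformly on every bounded interval. -/

import Mathlib

open MeasureTheory Filter Topology
open scoped NNReal ENNReal

/-- The order of an entire function: the infimum of the exponents `A ≥ 0` such that
`f z = O(exp(|z| ^ A))` as `|z| → ∞`; it is `∞` if there is no such exponent. -/
noncomputable def entireOrder (f : ℂ → ℂ) : ℝ≥0∞ :=
  ⨅ (A : ℝ≥0) (_ : f =O[cocompact ℂ] fun z : ℂ => Real.exp (‖z‖ ^ (A : ℝ))), (A : ℝ≥0∞)

/-- A strictly increasing sequence of positive numbers (indexed from `0`), tending to infinity. -/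
structure IsIncreasingPosSeq (a : ℕ → ℝ) : Prop where
  pos : ∀ n, 0 < a n
  strictMono : StrictMono a
  tendsto_atTop : Tendsto a atTop atTop

/-- The zeros of `f` are exactly the points `a n` and `- a n`, and all of them are simple. -/
def HasSimpleZerosAt (f : ℂ → ℂ) (a : ℕ → ℝ) : Prop :=
  (∀ z : ℂ, f z = 0 ↔ ∃ n, z = (a n : ℂ) ∨ z = -(a n : ℂ)) ∧
    ∀ z : ℂ, f z = 0 → analyticOrderAt f z = 1

/-- The Laplace law with parameter `r > 0`: density `(r / 2) * exp (- r * |x|)`. -/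
noncomputable def laplaceMeasure (r : ℝ) : Measure ℝ :=
  volume.withDensity fun x => ENNReal.ofReal (r / 2 * Real.exp (-(r * |x|)))

/-- The mixture `p δ₀ + (1 - p) Laplace(r)`, for `p ∈ [0, 1]` and `r > 0`. -/
noncomputable def diracLaplaceMixture (p r : ℝ) : Measure ℝ :=
  ENNReal.ofReal p • Measure.dirac 0 + ENNReal.ofReal (1 - p) • laplaceMeasure r

/-- The convolution `ν 0 ∗ ⋯ ∗ ν (N - 1)` of the first `N` terms of a sequence of laws. -/
noncomputable def partialConv (ν : ℕ → ProbabilityMeasure ℝ) : ℕ → ProbabilityMeasure ℝ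
  | 0 => ⟨Measure.dirac 0, inferInstance⟩
  | N + 1 => ⟨(partialConv ν N : Measure ℝ).conv (ν N : Measure ℝ), inferInstance⟩

/-- `μ` is the (convergent) infinite convolution of the laws `ν n`: the finite convolutions converge
weakly to `μ`, and the products of the characteristic functions of the `ν n` converge to that of `μ`
uniformly on every bounded interval. -/
structure IsInfiniteConvolution (ν : ℕ → ProbabilityMeasure ℝ) (μ : ProbabilityMeasure ℝ) :
    Prop where
  tendsto_partialConv : Tendsto (partialConv ν) atTop (𝓝 μ)
  tendsto_charFun : ∀ R : ℝ, TendstoUniformlyOn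
    (fun (N : ℕ) (t : ℝ) => ∏ n ∈ Finset.range N, charFun (ν n : Measure ℝ) t)
    (fun t : ℝ => charFun (μ : Measure ℝ) t) atTop (Set.Icc (-R) R)

/-! By Hadamard, `g(it) = ∏ (1 + t²/a_n²)` and likewise for `h`, so `h(it)/g(it)` is the product of
`(1 + t²/b_n²)/(1 + t²/a_n²)`. With `p = a_n²/b_n² < 1`, each factor equals `p + (1 - p) a_n²/(a_n²
+ t²)`, the characteristic function of `ν_n`. Lévy's continuity theorem then gives `μ`. The factors
lie in `[0, 1]`, so the partial products decrease and Dini's theorem makes the convergence locally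
uniform.

The Hadamard product is obtained without canonical products. Write `f = P_N Q_N` with `P_N` the
first `N` quadratic factors. On `|z| = 2 a_N` one has `|P_N| ≥ 1`, so growth and the maximum
principle bound `Q_N` inside. `Q_N` is zero-free on `|z| < a_N` and even, so its logarithm vanishes
to second order at `0`; Borel–Carathéodory and Schwarz give `|log Q_N(z)| = O(a_N^A |z|²/a_N²)` up
to a term `O(|z|²/a_N²)`. This tends to `0` because `A < 2`. -/

/-! ### Splitting off quadratic factors -/

/-- An entire function that vanishes at `c` is divisible by `z - c`. -/
theorem Differentiable.exists_eq_sub_mul {f : ℂ → ℂ} (hf : Differentiable ℂ f) {c : ℂ}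
    (hc : f c = 0) : ∃ q : ℂ → ℂ, Differentiable ℂ q ∧ ∀ z, f z = (z - c) * q z := by
  refine ⟨dslope f c, ?_, fun z => ?_⟩
  · rw [← differentiableOn_univ, Complex.differentiableOn_dslope univ_mem]
    exact hf.differentiableOn
  · have := sub_smul_dslope f c z
    simpa [hc] using this.symm

/-- Dividing an even entire function with simple zeros `± a n` by `1 - z ^ 2 / a 0 ^ 2`. -/
theorem HasSimpleZerosAt.exists_eq_mul {f : ℂ → ℂ} {a : ℕ → ℝ} (hf : Differentiable ℂ f)
    (hev : Function.Even f) (ha : ∀ n, 0 < a n) (hinj : Function.Injective a)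
    (hz : HasSimpleZerosAt f a) :
    ∃ q : ℂ → ℂ, Differentiable ℂ q ∧ Function.Even q ∧
      (∀ z, f z = (1 - z ^ 2 / (a 0 : ℂ) ^ 2) * q z) ∧
      HasSimpleZerosAt q fun n => a (n + 1) := by
  set c : ℂ := (a 0 : ℂ) with hcdef
  have hc : c ≠ 0 := by simpa [hcdef] using (ha 0).ne'
  have hcc : c ≠ -c := fun h => hc (self_eq_neg.mp h)
  have hfc : f c = 0 := (hz.1 _).2 ⟨0, .inl rfl⟩
  have hfc' : f (-c) = 0 := (hz.1 _).2 ⟨0, .inr rfl⟩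
  obtain ⟨u, hu, hfu⟩ := hf.exists_eq_sub_mul hfc
  have huc : u (-c) = 0 := by
    have := hfu (-c)
    rw [hfc', eq_comm, mul_eq_zero, sub_eq_zero] at this
    exact this.resolve_left hcc.symm
  obtain ⟨v, hv, huv⟩ := hu.exists_eq_sub_mul huc
  set p : ℂ → ℂ := fun z => 1 - z ^ 2 / c ^ 2 with hp
  have hpd : Differentiable ℂ p := by fun_prop
  have hp0 (z : ℂ) : p z = 0 ↔ z = c ∨ z = -c := by
    rw [← sq_eq_sq_iff_eq_or_eq_neg, hp]
    simp only [sub_eq_zero]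
    rw [eq_comm, div_eq_one_iff_eq (pow_ne_zero 2 hc)]
  set q : ℂ → ℂ := fun z => -c ^ 2 * v z with hq
  have hqd : Differentiable ℂ q := by fun_prop
  have hfq (z : ℂ) : f z = p z * q z := by
    rw [hfu, huv, hp, hq]
    field_simp
    ring
  have hfpq : f = p * q := funext hfq
  have hord (z : ℂ) : analyticOrderAt f z = analyticOrderAt p z + analyticOrderAt q z := by
    rw [hfpq]
    exact analyticOrderAt_mul (hpd.analyticAt z) (hqd.analyticAt z)
  -- A common zero of `p` and `q` would be a zero of `f` of order at least 2.
  have hqp {z : ℂ} (hqz : q z = 0) : p z ≠ 0 := by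
    intro hpz
    have h1 : analyticOrderAt f z = 1 := hz.2 z (by rw [hfq, hpz, zero_mul])
    have h2 : 1 ≤ analyticOrderAt p z := by
      rw [Order.one_le_iff_ne_zero, (hpd.analyticAt z).analyticOrderAt_ne_zero]
      exact hpz
    have h3 : 1 ≤ analyticOrderAt q z := by
      rw [Order.one_le_iff_ne_zero, (hqd.analyticAt z).analyticOrderAt_ne_zero]
      exact hqz
    have := add_le_add h2 h3
    rw [← hord, h1] at this
    exact absurd this (by decide)
  have hpev (z : ℂ) : p (-z) = p z := by simp [hp]
  refine ⟨q, hqd, ?_, hfq, fun z => ⟨fun hqz => ?_, ?_⟩, fun z hqz => ?_⟩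
  -- Cancelling `p` gives evenness off `±c`; continuity extends it to these two points.
  · have hcont := hqd.continuous
    have hdense : Dense {z : ℂ | p z ≠ 0} := by
      have : {z : ℂ | p z ≠ 0} = ({c, -c} : Set ℂ)ᶜ := by
        ext z; simp [hp0]
      rw [this]
      exact (Set.toFinite _).countable.dense_compl ℂ
    intro z
    refine congrFun (Continuous.ext_on hdense (hcont.comp continuous_neg) hcont ?_) z
    intro w hw
    refine mul_left_cancel₀ hw ?_
    rw [← hfq, ← hev w, hfq, hpev]
    rfl
  · obtain ⟨n, hn⟩ := (hz.1 z).1 (by rw [hfq, hqz, mul_zero])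
    cases n with
    | zero => exact absurd ((hp0 z).2 hn) (hqp hqz)
    | succ n => exact ⟨n, hn⟩
  · rintro ⟨n, hn⟩
    have hfz : f z = 0 := (hz.1 z).2 ⟨n + 1, hn⟩
    rw [hfq, mul_eq_zero] at hfz
    refine hfz.resolve_left fun hpz => ?_
    have hne : a (n + 1) ≠ a 0 := fun h => absurd (hinj h) (by simp)
    have hne' : a (n + 1) ≠ -a 0 := by linarith [ha 0, ha (n + 1)]
    dsimp only at hn
    rw [hcdef] at hp0
    rcases hn with rfl | rfl <;> rcases (hp0 _).1 hpz with h | h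
    · exact hne (by exact_mod_cast h)
    · exact hne' (by exact_mod_cast h)
    · exact hne' (by rw [← neg_eq_iff_eq_neg]; exact_mod_cast h)
    · exact hne (by exact_mod_cast neg_injective h)
  · have hpz : analyticOrderAt p z = 0 :=
      (hpd.analyticAt z).analyticOrderAt_eq_zero.2 (hqp hqz)
    have := hord z
    rw [hz.2 z (by rw [hfq, hqz, mul_zero]), hpz, zero_add] at this
    exact this.symm

/-- Dividing an even entire function with simple zeros `± a n` by the product of its first `N`
quadratic factors. -/
theorem HasSimpleZerosAt.exists_eq_prod_mul {f : ℂ → ℂ} {a : ℕ → ℝ} (hf : Differentiable ℂ f)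
    (hev : Function.Even f) (ha : ∀ n, 0 < a n) (hinj : Function.Injective a)
    (hz : HasSimpleZerosAt f a) (N : ℕ) :
    ∃ q : ℂ → ℂ, Differentiable ℂ q ∧ Function.Even q ∧
      (∀ z, f z = (∏ n ∈ Finset.range N, (1 - z ^ 2 / (a n : ℂ) ^ 2)) * q z) ∧
      HasSimpleZerosAt q fun n => a (n + N) := by
  induction N with
  | zero => exact ⟨f, hf, hev, by simp, hz⟩
  | succ N ih =>
    obtain ⟨q, hq, hqev, hfq, hqz⟩ := ih
    obtain ⟨r, hr, hrev, hqr, hrz⟩ := hqz.exists_eq_mul hq hqev (fun n => ha _)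
      fun m n h => add_right_cancel (hinj h)
    refine ⟨r, hr, hrev, fun z => ?_, by simpa only [add_assoc, add_comm 1] using hrz⟩
    rw [hfq, hqr, Finset.prod_range_succ, zero_add, mul_assoc]

/-! ### Logarithms and growth bounds -/

/-- A zero-free holomorphic function on a disc, normalised to be `1` at the centre, has a
holomorphic logarithm there. -/
theorem exists_exp_eq_of_differentiableOn_ball {f : ℂ → ℂ} {R : ℝ} (hR : 0 < R)
    (hf : DifferentiableOn ℂ f (Metric.ball 0 R)) (h0 : f 0 = 1)
    (hne : ∀ z ∈ Metric.ball (0 : ℂ) R, f z ≠ 0) :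
    ∃ q : ℂ → ℂ, q 0 = 0 ∧ (∀ z ∈ Metric.ball (0 : ℂ) R, HasDerivAt q (deriv f z / f z) z) ∧
      ∀ z ∈ Metric.ball (0 : ℂ) R, f z = Complex.exp (q z) := by
  have hd : DifferentiableOn ℂ (fun z => deriv f z / f z) (Metric.ball 0 R) :=
    (hf.deriv Metric.isOpen_ball).div hf hne
  obtain ⟨q, hq0, hq⟩ := hd.isExactOn_ball.with_val_at 0 0
  refine ⟨q, hq0, hq, fun z hz => ?_⟩
  have hderiv (w : ℂ) (hw : w ∈ Metric.ball (0 : ℂ) R) :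
      HasDerivAt (fun w => f w * Complex.exp (-q w)) 0 w := by
    have h1 := ((hf.differentiableAt (Metric.isOpen_ball.mem_nhds hw)).hasDerivAt).mul
      (hq w hw).neg.cexp
    refine h1.congr_deriv ?_
    have := hne w hw
    field_simp
    ring
  have hconst := (convex_ball (0 : ℂ) R).is_const_of_fderivWithin_eq_zero (𝕜 := ℂ)
    (f := fun w => f w * Complex.exp (-q w))
    (fun w hw => (hderiv w hw).differentiableAt.differentiableWithinAt)
    (fun w hw => by
      rw [fderivWithin_of_isOpen Metric.isOpen_ball hw]
      ext
      simp [(hderiv w hw).deriv])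
    hz (Metric.mem_ball_self hR)
  simp only [hq0, h0, neg_zero, Complex.exp_zero, mul_one] at hconst
  rw [Complex.exp_neg] at hconst
  exact (mul_inv_eq_one₀ (Complex.exp_ne_zero _)).1 hconst

/-- A holomorphic function on a disc whose real part is at most `M` and which vanishes to second
order at the centre is `O(M (|z| / R) ^ 2)`. -/
theorem Complex.norm_le_of_re_le_of_hasDerivAt_zero {q : ℂ → ℂ} {R M : ℝ} (hR : 0 < R)
    (hM : 0 < M) (hq : DifferentiableOn ℂ q (Metric.ball 0 R)) (h0 : q 0 = 0)
    (h0' : HasDerivAt q 0 0) (hre : ∀ z ∈ Metric.ball (0 : ℂ) R, (q z).re ≤ M) {z : ℂ}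
    (hz : ‖z‖ < R / 2) : ‖q z‖ ≤ 2 * M * (‖z‖ / (R / 2)) ^ 2 := by
  have hsub : Metric.ball (0 : ℂ) (R / 2) ⊆ Metric.ball 0 R :=
    Metric.ball_subset_ball (by linarith)
  have hbd (w : ℂ) (hw : w ∈ Metric.ball (0 : ℂ) (R / 2)) : ‖q w‖ ≤ 2 * M := by
    have h1 := Complex.borelCaratheodory_zero hM hq hre hR (hsub hw) h0
    rw [mem_ball_zero_iff] at hw
    refine h1.trans ?_
    rw [div_le_iff₀ (by linarith)]
    gcongr
    linarith
  -- Schwarz lemma: `q = o(z^n)` yields exponent `n + 1`, so `n = 1` gives the square.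
  have := Complex.dist_le_mul_div_pow_of_mapsTo_ball_of_isLittleO (n := 1) (f := q) (c := 0)
    (z := z) (R₁ := R / 2) (R₂ := 2 * M) (hq.mono hsub)
    (fun w hw => by simpa [h0] using hbd w hw)
    (by
      simp only [pow_one, Asymptotics.isLittleO_norm_right]
      simpa [h0] using h0'.isLittleO)
    (by simpa using hz)
  simpa [h0] using this

/-- A function of order less than `2` has a global growth bound with an exponent less than `2`. -/
theorem exists_norm_le_exp_of_entireOrder_lt_two {f : ℂ → ℂ} (hf : Continuous f)
    (h : entireOrder f < 2) :
    ∃ A : ℝ, A < 2 ∧ ∃ K : ℝ, 1 < K ∧ ∀ z, ‖f z‖ ≤ K * Real.exp (‖z‖ ^ A) := by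
  obtain ⟨A, hA⟩ := iInf_lt_iff.1 h
  obtain ⟨hO, hA⟩ := iInf_lt_iff.1 hA
  refine ⟨A, by exact_mod_cast hA, ?_⟩
  obtain ⟨C, hC⟩ := hO.bound
  obtain ⟨S, hS, hCS⟩ := mem_cocompact.1 hC
  obtain ⟨B, hB⟩ := hS.exists_bound_of_continuousOn hf.continuousOn
  -- The 2 forces `K > 1`, so that `log K > 0` later.
  refine ⟨max (max C B) 2, lt_max_of_lt_right one_lt_two, fun z => ?_⟩
  have h1 : 1 ≤ Real.exp (‖z‖ ^ (A : ℝ)) := Real.one_le_exp (by positivity)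
  by_cases hz : z ∈ S
  · calc ‖f z‖ ≤ B * 1 := by simpa using hB z hz
      _ ≤ max (max C B) 2 * Real.exp (‖z‖ ^ (A : ℝ)) := by
        gcongr
        exact (le_max_right _ _).trans (le_max_left _ _)
  · have := hCS hz
    simp only [Set.mem_ofPred_eq, Real.norm_eq_abs, Real.abs_exp] at this
    refine this.trans ?_
    gcongr
    exact (le_max_left _ _).trans (le_max_left _ _)

/-! ### Hadamard product -/

/-- **Hadamard factorisation** for even entire functions of order less than `2` with simple real
zeros. -/
theorem HasSimpleZerosAt.tendsto_prod {f : ℂ → ℂ} {a : ℕ → ℝ} (hf : Differentiable ℂ f)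
    (hev : Function.Even f) (hord : entireOrder f < 2) (h0 : f 0 = 1)
    (ha : IsIncreasingPosSeq a) (hz : HasSimpleZerosAt f a) (z : ℂ) :
    Tendsto (fun N => ∏ n ∈ Finset.range N, (1 - z ^ 2 / (a n : ℂ) ^ 2)) atTop (𝓝 (f z)) := by
  obtain ⟨A, hA, K, hK, hbound⟩ := exists_norm_le_exp_of_entireOrder_lt_two hf.continuous hord
  choose Q hQd hQev hfQ hQz using hz.exists_eq_prod_mul hf hev ha.pos ha.strictMono.injective
  set M : ℕ → ℝ := fun N => Real.log K + (2 * a N) ^ A with hMdef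
  have hM (N : ℕ) : 0 < M N := by
    have := ha.pos N
    exact add_pos_of_pos_of_nonneg (Real.log_pos hK) (by positivity)
  have hQ0 (N : ℕ) : Q N 0 = 1 := by
    have := hfQ N 0
    simpa [h0] using this.symm
  have hQne (N : ℕ) : ∀ w ∈ Metric.ball (0 : ℂ) (a N), Q N w ≠ 0 := by
    intro w hw hQw
    obtain ⟨n, hn⟩ := ((hQz N).1 w).1 hQw
    have hnorm : ‖w‖ = a (n + N) := by
      rcases hn with rfl | rfl <;> simp [abs_of_pos (ha.pos _)]
    rw [mem_ball_zero_iff, hnorm] at hw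
    exact absurd (ha.strictMono.monotone (Nat.le_add_left N n)) (not_le.2 hw)
  have hQbound (N : ℕ) (w : ℂ) (hw : w ∈ Metric.ball (0 : ℂ) (a N)) :
      ‖Q N w‖ ≤ Real.exp (M N) := by
    have haN := ha.pos N
    have h2 : (2 * a N) ≠ 0 := by positivity
    -- On the doubled radius, `|u²/a_n²| ≥ 4` for `n < N`, so each factor has modulus at least 3.
    refine Complex.norm_le_of_forall_mem_frontier_norm_le (U := Metric.ball 0 (2 * a N))
      Metric.isBounded_ball (hQd N).diffContOnCl (fun u hu => ?_)
      (subset_closure (Metric.ball_subset_ball (by linarith) hw))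
    rw [frontier_ball _ h2, mem_sphere_zero_iff_norm] at hu
    have hprod : 1 ≤ ‖∏ n ∈ Finset.range N, (1 - u ^ 2 / (a n : ℂ) ^ 2)‖ := by
      rw [norm_prod]
      refine Finset.one_le_prod fun n hn => ?_
      have han := ha.pos n
      have hlt : a n ≤ a N := (ha.strictMono (Finset.mem_range.1 hn)).le
      have h4 : 4 ≤ ‖u ^ 2 / (a n : ℂ) ^ 2‖ := by
        rw [norm_div, norm_pow, norm_pow, hu, Complex.norm_real, Real.norm_eq_abs,
          abs_of_pos han, le_div_iff₀ (by positivity)]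
        nlinarith
      have := norm_sub_norm_le (u ^ 2 / (a n : ℂ) ^ 2) 1
      rw [norm_one, norm_sub_rev] at this
      linarith
    calc ‖Q N u‖ ≤ ‖∏ n ∈ Finset.range N, (1 - u ^ 2 / (a n : ℂ) ^ 2)‖ * ‖Q N u‖ :=
          le_mul_of_one_le_left (norm_nonneg _) hprod
      _ = ‖f u‖ := by rw [← norm_mul, ← hfQ]
      _ ≤ K * Real.exp ((2 * a N) ^ A) := by simpa [hu] using hbound u
      _ = Real.exp (M N) := by rw [hMdef, Real.exp_add, Real.exp_log (by linarith)]
  have hexp : ∀ N, ∃ q : ℂ, ‖z‖ < a N / 2 →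
      Q N z = Complex.exp q ∧ ‖q‖ ≤ 2 * M N * (‖z‖ / (a N / 2)) ^ 2 := by
    intro N
    obtain ⟨q, hq0, hqd, hqe⟩ := exists_exp_eq_of_differentiableOn_ball (ha.pos N)
      (hQd N).differentiableOn (hQ0 N) (hQne N)
    have haN := ha.pos N
    refine ⟨q z, fun hzN => ⟨hqe z (by rw [mem_ball_zero_iff]; linarith), ?_⟩⟩
    refine Complex.norm_le_of_re_le_of_hasDerivAt_zero haN (hM N)
      (fun w hw => (hqd w hw).differentiableAt.differentiableWithinAt) hq0 ?_ (fun w hw => ?_) hzN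
    · have hodd : deriv (Q N) 0 = 0 := by
        have h1 := deriv_comp_neg (Q N) 0
        rw [show (fun w => Q N (-w)) = Q N from funext (hQev N), neg_zero] at h1
        exact self_eq_neg.1 h1
      simpa [hodd] using hqd 0 (Metric.mem_ball_self haN)
    · have := hQbound N w hw
      rwa [hqe w hw, Complex.norm_exp, Real.exp_le_exp] at this
  choose q hq using hexp
  have hlarge : ∀ᶠ N in atTop, ‖z‖ < a N / 2 :=
    (ha.tendsto_atTop.atTop_div_const two_pos).eventually_gt_atTop _
  have hq0 : Tendsto q atTop (𝓝 0) := by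
    refine squeeze_zero_norm' (hlarge.mono fun N hN => (hq N hN).2) ?_
    -- The bound on `q N` is `8‖z‖²` times this expression at `x = a N`; `A < 2` makes it vanish.
    have e1 : Tendsto (fun x : ℝ => Real.log K * (x ^ 2)⁻¹ + 2 ^ A * x ^ (-(2 - A))) atTop
        (𝓝 (Real.log K * 0 + 2 ^ A * 0)) :=
      ((tendsto_pow_atTop two_ne_zero).inv_tendsto_atTop.const_mul _).add
        ((tendsto_rpow_neg_atTop (by linarith)).const_mul _)
    have e2 := (e1.comp ha.tendsto_atTop).const_mul (8 * ‖z‖ ^ 2)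
    simp only [mul_zero, add_zero] at e2
    refine e2.congr fun N => ?_
    have haN := ha.pos N
    simp only [Function.comp_apply, hMdef]
    rw [Real.mul_rpow two_pos.le haN.le, neg_sub, Real.rpow_sub haN, Real.rpow_two]
    field_simp
    ring
  have hQ1 : Tendsto (fun N => Q N z) atTop (𝓝 1) := by
    have := (Complex.continuous_exp.tendsto 0).comp hq0
    rw [Complex.exp_zero] at this
    exact this.congr' (hlarge.mono fun N hN => (hq N hN).1.symm)
  have hlim : Tendsto (fun N => f z / Q N z) atTop (𝓝 (f z / 1)) :=
    tendsto_const_nhds.div hQ1 one_ne_zero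
  rw [div_one] at hlim
  refine hlim.congr' (hlarge.mono fun N hN => ?_)
  rw [hfQ N z, mul_div_cancel_right₀]
  rw [(hq N hN).1]
  exact Complex.exp_ne_zero _

/-! ### Laplace laws and their mixtures -/

/-- Both the integrability and the Fourier integral of the Laplace density. -/
theorem integral_exp_mul_laplaceDensity {r : ℝ} (hr : 0 < r) (t : ℝ) :
    Integrable (fun x : ℝ => Complex.exp (t * x * Complex.I) * (r / 2 * Real.exp (-(r * |x|)))) ∧
    ∫ x : ℝ, Complex.exp (t * x * Complex.I) * (r / 2 * Real.exp (-(r * |x|)))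
      = r ^ 2 / (r ^ 2 + t ^ 2) := by
  have hre : (t * Complex.I - r : ℂ).re < 0 := by simpa using hr
  have hre' : 0 < (t * Complex.I + r : ℂ).re := by simpa using hr
  have hne : (t * Complex.I - r : ℂ) ≠ 0 := fun h => by simp [h] at hre
  have hne' : (t * Complex.I + r : ℂ) ≠ 0 := fun h => by simp [h] at hre'
  have hpos : Set.EqOn
      (fun x : ℝ => (r / 2 : ℂ) * Complex.exp ((t * Complex.I - r) * x))
      (fun x : ℝ => Complex.exp (t * x * Complex.I) * (r / 2 * Real.exp (-(r * |x|))))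
      (Set.Ioi 0) := by
    intro x hx
    simp only [abs_of_pos (Set.mem_Ioi.1 hx)]
    push_cast
    rw [mul_left_comm, ← Complex.exp_add]
    ring_nf
  have hneg : Set.EqOn
      (fun x : ℝ => (r / 2 : ℂ) * Complex.exp ((t * Complex.I + r) * x))
      (fun x : ℝ => Complex.exp (t * x * Complex.I) * (r / 2 * Real.exp (-(r * |x|))))
      (Set.Iic 0) := by
    intro x hx
    simp only [abs_of_nonpos (Set.mem_Iic.1 hx)]
    push_cast
    rw [mul_left_comm, ← Complex.exp_add]
    ring_nf
  have i1 := IntegrableOn.congr_fun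
    ((integrableOn_exp_mul_complex_Ioi hre 0).const_mul (r / 2 : ℂ)) hpos measurableSet_Ioi
  have i2 := IntegrableOn.congr_fun
    ((integrableOn_exp_mul_complex_Iic hre' 0).const_mul (r / 2 : ℂ)) hneg measurableSet_Iic
  refine ⟨by rw [← integrableOn_univ, ← Set.Iic_union_Ioi (a := (0 : ℝ))]; exact i2.union i1, ?_⟩
  rw [← intervalIntegral.integral_Iic_add_Ioi i2 i1, ← setIntegral_congr_fun measurableSet_Ioi hpos,
    ← setIntegral_congr_fun measurableSet_Iic hneg, integral_const_mul, integral_const_mul,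
    integral_exp_mul_complex_Ioi hre, integral_exp_mul_complex_Iic hre']
  have h2 : (r ^ 2 + t ^ 2 : ℂ) ≠ 0 := by
    have : 0 < r ^ 2 + t ^ 2 := by positivity
    exact_mod_cast this.ne'
  simp only [Complex.ofReal_zero, mul_zero, Complex.exp_zero]
  field_simp
  ring_nf
  simp only [Complex.I_sq]
  ring

theorem charFun_laplaceMeasure {r : ℝ} (hr : 0 < r) (t : ℝ) :
    charFun (laplaceMeasure r) t = r ^ 2 / (r ^ 2 + t ^ 2) := by
  rw [charFun_apply_real, laplaceMeasure,
    integral_withDensity_eq_integral_toReal_smul (by fun_prop) (by simp),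
    ← (integral_exp_mul_laplaceDensity hr t).2]
  refine integral_congr_ae (.of_forall fun x => ?_)
  simp only
  rw [ENNReal.toReal_ofReal (by positivity), Complex.real_smul, mul_comm]
  push_cast
  rfl

theorem isProbabilityMeasure_laplaceMeasure {r : ℝ} (hr : 0 < r) :
    IsProbabilityMeasure (laplaceMeasure r) := by
  obtain ⟨hint, hval⟩ := integral_exp_mul_laplaceDensity hr 0
  have hcast : (fun x : ℝ => Complex.exp ((0 : ℝ) * x * Complex.I) *
      (r / 2 * Real.exp (-(r * |x|)))) =
      fun x : ℝ => ((r / 2 * Real.exp (-(r * |x|)) : ℝ) : ℂ) := by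
    ext x
    simp
  rw [hcast] at hint hval
  have hr' : (r : ℂ) ≠ 0 := by exact_mod_cast hr.ne'
  have hval' : ∫ x : ℝ, r / 2 * Real.exp (-(r * |x|)) = 1 := by
    rw [integral_complex_ofReal] at hval
    have h1 : (r ^ 2 / (r ^ 2 + ((0 : ℝ) : ℂ) ^ 2) : ℂ) = 1 := by simp [hr']
    rw [h1] at hval
    exact_mod_cast hval
  have hint' : Integrable fun x : ℝ => r / 2 * Real.exp (-(r * |x|)) := by
    simpa only [RCLike.re_to_complex, Complex.ofReal_re] using hint.re
  constructor
  rw [laplaceMeasure, withDensity_apply _ .univ, Measure.restrict_univ,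
    ← ofReal_integral_eq_lintegral_ofReal hint' (.of_forall fun x => by positivity), hval',
    ENNReal.ofReal_one]

theorem isProbabilityMeasure_diracLaplaceMixture {p r : ℝ} (hp : 0 ≤ p) (hp1 : p ≤ 1)
    (hr : 0 < r) : IsProbabilityMeasure (diracLaplaceMixture p r) := by
  have := isProbabilityMeasure_laplaceMeasure hr
  constructor
  simp only [diracLaplaceMixture, Measure.add_apply, Measure.smul_apply, measure_univ, smul_eq_mul,
    mul_one]
  rw [← ENNReal.ofReal_add hp (by linarith)]
  simp

theorem charFun_diracLaplaceMixture {p r : ℝ} (hp : 0 ≤ p) (hp1 : p ≤ 1) (hr : 0 < r) (t : ℝ) :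
    charFun (diracLaplaceMixture p r) t = p + (1 - p) * (r ^ 2 / (r ^ 2 + t ^ 2)) := by
  have := isProbabilityMeasure_laplaceMeasure hr
  rw [← charFun_laplaceMeasure hr]
  have hb (μ : Measure ℝ) [IsFiniteMeasure μ] :
      Integrable (fun x : ℝ => Complex.exp (t * x * Complex.I)) μ := by
    refine Integrable.of_bound (by fun_prop) 1 (.of_forall fun x => ?_)
    rw [← Complex.ofReal_mul, Complex.norm_exp_ofReal_mul_I]
  simp only [charFun_apply_real, diracLaplaceMixture]
  rw [integral_add_measure ((hb _).smul_measure (by simp)) ((hb _).smul_measure (by simp)),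
    integral_smul_measure, integral_smul_measure, ENNReal.toReal_ofReal hp,
    ENNReal.toReal_ofReal (by linarith)]
  simp

theorem charFun_partialConv (ν : ℕ → ProbabilityMeasure ℝ) (N : ℕ) (t : ℝ) :
    charFun (partialConv ν N : Measure ℝ) t =
      ∏ n ∈ Finset.range N, charFun (ν n : Measure ℝ) t := by
  induction N with
  | zero => simp [partialConv]
  | succ N ih =>
    rw [Finset.prod_range_succ, ← ih]
    exact charFun_conv t

/-! ### Weak convergence -/

/-- **Lévy's continuity theorem**: if the characteristic functions of a sequence of laws converge
pointwise to a function continuous at `0`, then the laws converge weakly to a law with that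
characteristic function. -/
theorem exists_tendsto_of_tendsto_charFun {μ : ℕ → ProbabilityMeasure ℝ} {φ : ℝ → ℂ}
    (hφ : ContinuousAt φ 0)
    (h : ∀ t, Tendsto (fun n => charFun (μ n : Measure ℝ) t) atTop (𝓝 (φ t))) :
    ∃ μ₀ : ProbabilityMeasure ℝ, (∀ t, charFun (μ₀ : Measure ℝ) t = φ t) ∧
      Tendsto μ atTop (𝓝 μ₀) := by
  have htight : IsTightMeasureSet
      {((ρ : ProbabilityMeasure ℝ) : Measure ℝ) | ρ ∈ Set.range μ} := by
    have := isTightMeasureSet_of_tendsto_charFun (μ := fun n => (μ n : Measure ℝ)) hφ h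
    refine this.subset ?_
    rintro _ ⟨_, ⟨n, rfl⟩, rfl⟩
    exact ⟨n, rfl⟩
  obtain ⟨μ₀, -, hμ₀⟩ := isCompact_closure_of_isTightMeasureSet htight
    (f := map μ atTop) (by
      rw [le_principal_iff, mem_map]
      exact univ_mem' fun n => subset_closure ⟨n, rfl⟩)
  have hchar (t : ℝ) : charFun (μ₀ : Measure ℝ) t = φ t := by
    have hcont : Continuous fun ρ : ProbabilityMeasure ℝ => charFun (ρ : Measure ℝ) t := by
      rw [continuous_iff_continuousAt]
      intro ρ
      have := (ProbabilityMeasure.tendsto_iff_forall_integral_rclike_tendsto ℂ).1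
        (tendsto_id (x := 𝓝 ρ)) (BoundedContinuousFunction.innerProbChar t)
      simpa only [ContinuousAt, charFun_eq_integral_innerProbChar, id] using! this
    -- A cluster value of a convergent sequence is its limit.
    have hcl : MapClusterPt (charFun (μ₀ : Measure ℝ) t) atTop
        (fun n => charFun (μ n : Measure ℝ) t) :=
      MapClusterPt.continuousAt_comp hcont.continuousAt hμ₀
    exact eq_of_nhds_neBot (NeBot.mono hcl (inf_le_inf_left _ (h t)))
  refine ⟨μ₀, hchar, ProbabilityMeasure.tendsto_iff_tendsto_charFun.2 fun t => ?_⟩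
  rw [hchar]
  exact h t

/-! ### The infinite product on the imaginary axis -/

/-- The Hadamard product on the imaginary axis. -/
theorem HasSimpleZerosAt.tendsto_prod_imaginary {f : ℂ → ℂ} {a : ℕ → ℝ}
    (hf : Differentiable ℂ f) (hev : Function.Even f) (hord : entireOrder f < 2) (h0 : f 0 = 1)
    (ha : IsIncreasingPosSeq a) (hz : HasSimpleZerosAt f a) (t : ℝ) :
    Tendsto (fun N => ((∏ n ∈ Finset.range N, (1 + t ^ 2 / a n ^ 2) : ℝ) : ℂ)) atTop
      (𝓝 (f (Complex.I * t))) := by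
  refine (hz.tendsto_prod hf hev hord h0 ha (Complex.I * t)).congr fun N => ?_
  push_cast
  refine Finset.prod_congr rfl fun n _ => ?_
  rw [mul_pow, Complex.I_sq]
  ring

/-- All zeros are real, so a zero on the imaginary axis could only be the origin. -/
theorem HasSimpleZerosAt.apply_imaginary_ne_zero {f : ℂ → ℂ} {a : ℕ → ℝ}
    (hz : HasSimpleZerosAt f a) (h0 : f 0 ≠ 0) (t : ℝ) : f (Complex.I * t) ≠ 0 := by
  intro h
  obtain ⟨n, hn⟩ := (hz.1 _).1 h
  have ht : t = 0 := by
    rcases hn with hn | hn <;> simpa using congrArg Complex.im hn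
  rw [ht, Complex.ofReal_zero, mul_zero] at h
  exact h0 h

/-- Dini's theorem for infinite products with factors in `[0, 1]`. -/
theorem tendstoUniformlyOn_prod_of_le_one {u : ℕ → ℝ → ℝ} {φ : ℝ → ℂ} {s : Set ℝ}
    (hs : IsCompact s) (hu : ∀ n, Continuous (u n)) (hu0 : ∀ n t, 0 ≤ u n t)
    (hu1 : ∀ n t, u n t ≤ 1) (hφ : Continuous φ)
    (h : ∀ t, Tendsto (fun N => ((∏ n ∈ Finset.range N, u n t : ℝ) : ℂ)) atTop (𝓝 (φ t))) :
    TendstoUniformlyOn (fun (N : ℕ) (t : ℝ) => ((∏ n ∈ Finset.range N, u n t : ℝ) : ℂ)) φ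
      atTop s := by
  have hre (t : ℝ) : Tendsto (fun N => ∏ n ∈ Finset.range N, u n t) atTop (𝓝 (φ t).re) := by
    simpa only [Function.comp_def, Complex.ofReal_re] using
      (Complex.continuous_re.tendsto _).comp (h t)
  -- Dini needs real values: `φ` is real as a limit of reals.
  have hφre (t : ℝ) : φ t = ((φ t).re : ℂ) :=
    tendsto_nhds_unique (h t) ((Complex.continuous_ofReal.tendsto _).comp (hre t))
  have hdini : TendstoUniformlyOn (fun (N : ℕ) (t : ℝ) => ∏ n ∈ Finset.range N, u n t)
      (fun t => (φ t).re) atTop s := by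
    refine Antitone.tendstoUniformlyOn_of_forall_tendsto hs
      (fun N => (continuous_finsetProd _ fun n _ => hu n).continuousOn) (fun t _ => ?_)
      (Complex.continuous_re.comp hφ).continuousOn (fun t _ => hre t)
    refine antitone_nat_of_succ_le fun N => ?_
    rw [Finset.prod_range_succ]
    exact mul_le_of_le_one_right (Finset.prod_nonneg fun n _ => hu0 n t) (hu1 N t)
  rw [funext hφre]
  exact Complex.isometry_ofReal.uniformContinuous.comp_tendstoUniformlyOn hdini

/-- The mixture `(a ^ 2 / b ^ 2) δ₀ + (1 - a ^ 2 / b ^ 2) Laplace(a)` has the characteristic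
function `(1 + t ^ 2 / b ^ 2) / (1 + t ^ 2 / a ^ 2)`. -/
theorem charFun_diracLaplaceMixture_sq_div_sq {a b : ℝ} (ha : 0 < a) (hab : a < b) (t : ℝ) :
    charFun (diracLaplaceMixture (a ^ 2 / b ^ 2) a) t =
      (((1 + t ^ 2 / b ^ 2) / (1 + t ^ 2 / a ^ 2) : ℝ) : ℂ) := by
  have hb := ha.trans hab
  rw [charFun_diracLaplaceMixture (by positivity) (div_le_one_of_le₀ (by gcongr) (by positivity))
    ha]
  have h1 : a ^ 2 + t ^ 2 ≠ 0 := by positivity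
  norm_cast
  field_simp
  ring

theorem mainTheorem4 (g h : ℂ → ℂ) (a b : ℕ → ℝ)
    (hg : Differentiable ℂ g) (hh : Differentiable ℂ h)
    (hg_even : Function.Even g) (hh_even : Function.Even h)
    (hg_order : 0 < entireOrder g ∧ entireOrder g < 2)
    (hh_order : 0 < entireOrder h ∧ entireOrder h < 2)
    (hg0 : g 0 = 1) (hh0 : h 0 = 1)
    (ha : IsIncreasingPosSeq a) (hb : IsIncreasingPosSeq b)
    (hg_zeros : HasSimpleZerosAt g a) (hh_zeros : HasSimpleZerosAt h b)
    (hab : ∀ n, a n < b n) :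
    ∃ μ : ProbabilityMeasure ℝ,
      (∀ t : ℝ, charFun (μ : Measure ℝ) t = h (Complex.I * t) / g (Complex.I * t)) ∧
      ∃ ν : ℕ → ProbabilityMeasure ℝ,
        (∀ n, (ν n : Measure ℝ) = diracLaplaceMixture (a n ^ 2 / b n ^ 2) (a n)) ∧
        IsInfiniteConvolution ν μ := by
  have hprob (n : ℕ) : IsProbabilityMeasure (diracLaplaceMixture (a n ^ 2 / b n ^ 2) (a n)) := by
    have han := ha.pos n
    have := hab n
    exact isProbabilityMeasure_diracLaplaceMixture (by positivity)
      (div_le_one_of_le₀ (by gcongr) (by positivity)) han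
  let ν : ℕ → ProbabilityMeasure ℝ := fun n => ⟨_, hprob n⟩
  set u : ℕ → ℝ → ℝ := fun n t => (1 + t ^ 2 / b n ^ 2) / (1 + t ^ 2 / a n ^ 2) with hu
  have hchar (n : ℕ) (t : ℝ) : charFun (ν n : Measure ℝ) t = (u n t : ℂ) :=
    charFun_diracLaplaceMixture_sq_div_sq (ha.pos n) (hab n) t
  have hprod (N : ℕ) (t : ℝ) : ∏ n ∈ Finset.range N, charFun (ν n : Measure ℝ) t =
      ((∏ n ∈ Finset.range N, u n t : ℝ) : ℂ) := by
    simp only [hchar, Complex.ofReal_prod]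
  have hgne := hg_zeros.apply_imaginary_ne_zero (by simp [hg0])
  set φ : ℝ → ℂ := fun t => h (Complex.I * t) / g (Complex.I * t) with hφdef
  have hφ : Continuous φ :=
    (hh.continuous.comp (by fun_prop)).div (hg.continuous.comp (by fun_prop)) hgne
  have hlim (t : ℝ) :
      Tendsto (fun N => ((∏ n ∈ Finset.range N, u n t : ℝ) : ℂ)) atTop (𝓝 (φ t)) := by
    refine ((hh_zeros.tendsto_prod_imaginary hh hh_even hh_order.2 hh0 hb t).div
      (hg_zeros.tendsto_prod_imaginary hg hg_even hg_order.2 hg0 ha t) (hgne t)).congr fun N => ?_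
    rw [Pi.div_apply, ← Complex.ofReal_div, ← Finset.prod_div_distrib]
  obtain ⟨μ, hμ, hconv⟩ := exists_tendsto_of_tendsto_charFun (μ := partialConv ν) hφ.continuousAt
    fun t => by simpa only [charFun_partialConv, hprod] using hlim t
  refine ⟨μ, hμ, ν, fun n => rfl, hconv, fun R => ?_⟩
  simp only [hprod, hμ]
  refine tendstoUniformlyOn_prod_of_le_one isCompact_Icc (fun n => ?_) (fun n t => by positivity)
    (fun n t => ?_) hφ hlim
  · refine Continuous.div (by fun_prop) (by fun_prop) fun t => by positivity
  -- This is where `a n < b n` makes the partial products decrease.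
  · have han := ha.pos n
    have := (hab n).le
    refine div_le_one_of_le₀ ?_ (by positivity)
    gcongr
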